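/- Let $V_4=\{e,(12)(34),(13)(24),(14)(23)\}\subset S_4$ be the Klein four group and let $X$ be the abstract simplicial complex on the 15-element vertex set $$V=(V_4\setminus\{e\})\sqcup(\{1,2,3,4\}\times\{1,2,3\})$$ whose simplices are all subsets of the sets $$\{\nu,(1,b_1),(2,b_2),(3,b_3),(4,b_4)\},\qquad \nu\in V_4\setminus\{e\},\quad b_1,b_2,b_3,b_4\in\{1,2,3\},$$ such that $b_{\nu(a)}\ne b_a$ for $a=1,2,3,4$. Then: 1. $X$ is a four-dimensional combinatorial manifold: for every vertex $v$ of $X$ (of either kind, $v=\nu$ or $v=(a,b)$), the geometric realization of the link of $v$, i.e. of the complex $\{\tau : v\notin\tau,\ \tau\cup\{v\}\in X\}$, is piecewise linearly homeomorphic to the boundary of a 4-dimensional simplex. 2. The link of the vertex $(12)(34)$ is isomorphic, as a simplicial complex, to the join of two 6-cycles (boundaries of hexagons). -/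

import Mathlib

/-! Abstract simplicial complexes are Mathlib's `PreAbstractSimplicialComplex`: downward closed
families of nonempty finite subsets of a type `α` (the empty simplex is left implicit, and a point of
`α` need not be a vertex). -/

namespace CombTop

/-- The vertices of `K`. -/
def vertices {α : Type*} (K : PreAbstractSimplicialComplex α) : Set α := {v | {v} ∈ K.faces}

/-- The link of `σ` in `K`: the simplices `τ` with `τ ∩ σ = ∅` and `τ ∪ σ ∈ K`. -/
def link {α : Type*} [DecidableEq α] (K : PreAbstractSimplicialComplex α) (σ : Finset α) :
    PreAbstractSimplicialComplex α where
  faces := {τ | τ.Nonempty ∧ τ ∩ σ = ∅ ∧ τ ∪ σ ∈ K.faces}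
  isRelLowerSet_faces := by
    rintro τ ⟨hτ, hd, hK⟩
    refine ⟨hτ, fun ρ hρ hne => ⟨hne, ?_, ?_⟩⟩
    · exact Finset.subset_empty.1 (hd ▸ Finset.inter_subset_inter_right hρ)
    · exact (K.isRelLowerSet_faces hK).2 (Finset.union_subset_union_left hρ)
        (hne.mono Finset.subset_union_left)

/-- The join `K * L`, on the disjoint union of the vertex sets: its simplices are the nonempty
disjoint unions of a possibly empty simplex of `K` and a possibly empty simplex of `L`. -/
def join {α β : Type*} (K : PreAbstractSimplicialComplex α) (L : PreAbstractSimplicialComplex β) :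
    PreAbstractSimplicialComplex (α ⊕ β) where
  faces := {σ | σ.Nonempty ∧ (σ.toLeft = ∅ ∨ σ.toLeft ∈ K.faces) ∧
    (σ.toRight = ∅ ∨ σ.toRight ∈ L.faces)}
  isRelLowerSet_faces := by
    rintro σ ⟨hσ, hl, hr⟩
    refine ⟨hσ, fun ρ hρ hne => ⟨hne, ?_, ?_⟩⟩
    · have hs : ρ.toLeft ⊆ σ.toLeft := Finset.toLeft_subset_toLeft hρ
      rcases hl with hl | hl
      · exact Or.inl (Finset.subset_empty.1 (hl ▸ hs))
      · rcases Finset.eq_empty_or_nonempty ρ.toLeft with h | h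
        · exact Or.inl h
        · exact Or.inr ((K.isRelLowerSet_faces hl).2 hs h)
    · have hs : ρ.toRight ⊆ σ.toRight := Finset.toRight_subset_toRight hρ
      rcases hr with hr | hr
      · exact Or.inl (Finset.subset_empty.1 (hr ▸ hs))
      · rcases Finset.eq_empty_or_nonempty ρ.toRight with h | h
        · exact Or.inl h
        · exact Or.inr ((L.isRelLowerSet_faces hr).2 hs h)

/-- The boundary of the `(n + 1)`-dimensional simplex, with vertices `0, …, n + 1`. -/
def simplexBoundary (n : ℕ) : PreAbstractSimplicialComplex (Fin (n + 2)) where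
  faces := {σ | σ.Nonempty ∧ σ ≠ Finset.univ}
  isRelLowerSet_faces := by
    rintro σ ⟨hσ, hu⟩
    refine ⟨hσ, fun ρ hρ hne => ⟨hne, ?_⟩⟩
    rintro rfl
    exact hu (Finset.univ_subset_iff.1 hρ)

/-- The circle triangulated as the boundary of a polygon with `n` vertices (`n ≥ 3`). -/
def cycle (n : ℕ) : PreAbstractSimplicialComplex (Fin n) :=
  (Geometry.AbstractSimplicialComplex.ofSimpleGraph
    (SimpleGraph.cycleGraph n)).toPreAbstractSimplicialComplex

/-- `K` and `L` are isomorphic: some bijection between their vertex sets takes simplices to simplices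
in both directions. -/
def Isomorphic {α β : Type*} (K : PreAbstractSimplicialComplex α)
    (L : PreAbstractSimplicialComplex β) : Prop :=
  ∃ e : vertices K ≃ vertices L, ∀ s : Finset (vertices K),
    s.map (Function.Embedding.subtype (· ∈ vertices K)) ∈ K.faces ↔
      (s.map e.toEmbedding).map (Function.Embedding.subtype (· ∈ vertices L)) ∈ L.faces

/-- The geometric realization `|K|` of a finite complex: the points of the standard simplex in `ℝ^α`
(points given by their barycentric coordinates) that lie on a face spanned by a simplex of `K`. -/
def realization {α : Type*} [Fintype α] (K : PreAbstractSimplicialComplex α) : Set (α → ℝ) :=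
  {x | x ∈ stdSimplex ℝ α ∧ ∃ σ ∈ K.faces, ∀ v, v ∉ σ → x v = 0}

/-- A convex polyhedron: the solution set of finitely many (non-strict) affine inequalities. -/
def IsConvexPolyhedron {E : Type*} [AddCommGroup E] [Module ℝ E] (P : Set E) : Prop :=
  ∃ Φ : Set (E →ᵃ[ℝ] ℝ), Φ.Finite ∧ P = {x | ∀ φ ∈ Φ, 0 ≤ φ x}

/-- A map `f : S → T` between subsets of real vector spaces is piecewise linear: `S` is the union of
finitely many convex polyhedra on each of which `f` is the restriction of an affine map. -/
def IsPiecewiseLinear {E F : Type*} [AddCommGroup E] [Module ℝ E] [AddCommGroup F] [Module ℝ F]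
    {S : Set E} {T : Set F} (f : S → T) : Prop :=
  ∃ Ps : Set (Set E), Ps.Finite ∧ ⋃₀ Ps = S ∧ ∀ P ∈ Ps, IsConvexPolyhedron P ∧
    ∃ A : E →ᵃ[ℝ] F, ∀ x : S, (x : E) ∈ P → (f x : F) = A x

/-- `|K|` and `|L|` are piecewise linearly homeomorphic. -/
def PLHomeomorphic {α β : Type*} [Fintype α] [Fintype β] (K : PreAbstractSimplicialComplex α)
    (L : PreAbstractSimplicialComplex β) : Prop :=
  ∃ h : realization K ≃ₜ realization L, IsPiecewiseLinear h ∧ IsPiecewiseLinear h.symm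

/-- `n`-dimensional combinatorial spheres. -/
def IsCombinatorialSphere {α : Type*} [Fintype α] (n : ℕ) (K : PreAbstractSimplicialComplex α) :
    Prop :=
  PLHomeomorphic K (simplexBoundary n)

/-- `n`-dimensional combinatorial manifolds: the links of all vertices are `(n - 1)`-dimensional
combinatorial spheres (for `n = 0`: empty). -/
def IsCombinatorialManifold {α : Type*} [Fintype α] [DecidableEq α] :
    ℕ → PreAbstractSimplicialComplex α → Prop
  | 0, K => ∀ v ∈ vertices K, link K {v} = ⊥
  | n + 1, K => ∀ v ∈ vertices K, IsCombinatorialSphere n (link K {v})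

/-- The Klein four group `V₄ = {e, (12)(34), (13)(24), (14)(23)}`; the letters `1, 2, 3, 4` are the
elements `0, 1, 2, 3` of `Fin 4`. -/
def kleinFour : Finset (Equiv.Perm (Fin 4)) :=
  {1, Equiv.swap 0 1 * Equiv.swap 2 3, Equiv.swap 0 2 * Equiv.swap 1 3,
    Equiv.swap 0 3 * Equiv.swap 1 2}

/-- The vertex set `(V₄ \ {e}) ⊔ ({1, 2, 3, 4} × {1, 2, 3})`. -/
abbrev XVertex : Type := {ν : Equiv.Perm (Fin 4) // ν ∈ kleinFour ∧ ν ≠ 1} ⊕ (Fin 4 × Fin 3)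

/-- The set `{ν, (1, b₁), (2, b₂), (3, b₃), (4, b₄)}`. -/
def facet (ν : {ν : Equiv.Perm (Fin 4) // ν ∈ kleinFour ∧ ν ≠ 1}) (b : Fin 4 → Fin 3) :
    Finset XVertex :=
  insert (Sum.inl ν) (Finset.univ.image fun a => Sum.inr (a, b a))

/-- The simplicial complex `X`: its simplices are the nonempty subsets of the sets
`{ν, (1, b₁), (2, b₂), (3, b₃), (4, b₄)}` with `b_{ν(a)} ≠ b_a` for all `a`. -/
def X : PreAbstractSimplicialComplex XVertex where
  faces := {σ | σ.Nonempty ∧ ∃ ν b, (∀ a, b (ν.1 a) ≠ b a) ∧ σ ⊆ facet ν b}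
  isRelLowerSet_faces := by
    rintro σ ⟨hσ, ν, b, hb, hs⟩
    exact ⟨hσ, fun ρ hρ hne => ⟨hne, ν, b, hb, hρ.trans hs⟩⟩

/-- The vertex `(12)(34)` of `X`. -/
def ν₁₂₃₄ : XVertex := Sum.inl ⟨Equiv.swap 0 1 * Equiv.swap 2 3, by decide⟩

end CombTop

/-! Both claims become finite checks once being a sphere has a combinatorial certificate.

A stellar subdivision does not change the PL type (`plHomeomorphic_stellarSubdivision`): the linear
map that sends the new vertex to the barycentre of the subdivided simplex `σ` is a homeomorphism of
realizations, and its inverse is linear on each region where one fixed coordinate from `σ` is the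
smallest. So a complex is a combinatorial 3-sphere if a sequence of welds, i.e. inverse stellar
subdivisions, reduces it to the boundary of a 4-simplex. Every vertex link of `X` has 12 vertices,
and an explicit list of seven welds brings it down to 5; `isCombinatorialSphere_of_weldsToSphere`
turns the evaluated check into a homeomorphism.

For ν = (12)(34) the facet condition only says b₁ ≠ b₂ and b₃ ≠ b₄. Pairs of distinct values are the
edges of K₃,₃ minus a perfect matching, which is a hexagon, and the two conditions are independent;
hence the join. -/

namespace CombTop

/-! ### Convex polyhedra and piecewise linear maps -/

section Polyhedra

variable {E F G : Type*} [AddCommGroup E] [Module ℝ E] [AddCommGroup F] [Module ℝ F]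
  [AddCommGroup G] [Module ℝ G]

theorem isConvexPolyhedron_setOf_forall {ι : Type*} [Finite ι] (φ : ι → E →ᵃ[ℝ] ℝ) :
    IsConvexPolyhedron {x | ∀ i, 0 ≤ φ i x} :=
  ⟨Set.range φ, Set.finite_range φ, by ext x; simp⟩

theorem IsConvexPolyhedron.inter {P Q : Set E} (hP : IsConvexPolyhedron P)
    (hQ : IsConvexPolyhedron Q) : IsConvexPolyhedron (P ∩ Q) := by
  obtain ⟨Φ, hΦ, rfl⟩ := hP
  obtain ⟨Ψ, hΨ, rfl⟩ := hQ
  refine ⟨Φ ∪ Ψ, hΦ.union hΨ, ?_⟩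
  ext x
  simp only [Set.mem_inter_iff, Set.mem_ofPred_eq, Set.mem_union, or_imp, forall_and]

theorem IsConvexPolyhedron.preimage {P : Set F} (hP : IsConvexPolyhedron P) (A : E →ᵃ[ℝ] F) :
    IsConvexPolyhedron (A ⁻¹' P) := by
  obtain ⟨Φ, hΦ, rfl⟩ := hP
  refine ⟨(fun φ => φ.comp A) '' Φ, hΦ.image _, ?_⟩
  ext x
  simp

theorem IsPiecewiseLinear.of_iUnion {ι : Type*} [Finite ι] {S : Set E} {T : Set F} {f : S → T}
    (P : ι → Set E) (A : ι → E →ᵃ[ℝ] F) (hP : ∀ i, IsConvexPolyhedron (P i))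
    (hS : ⋃ i, P i = S) (hf : ∀ i, ∀ x : S, (x : E) ∈ P i → (f x : F) = A i x) :
    IsPiecewiseLinear f := by
  refine ⟨Set.range P, Set.finite_range P, by rw [Set.sUnion_range, hS], ?_⟩
  rintro _ ⟨i, rfl⟩
  exact ⟨hP i, A i, hf i⟩

/-- The pieces are P ∩ A⁻¹(Q), where A is the affine map of the piece P of `f` and Q is a piece of
`g`. -/
theorem IsPiecewiseLinear.comp {S : Set E} {T : Set F} {U : Set G} {g : T → U} {f : S → T}
    (hg : IsPiecewiseLinear g) (hf : IsPiecewiseLinear f) : IsPiecewiseLinear (g ∘ f) := by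
  obtain ⟨Ps, hPs, hS, hP⟩ := hf
  obtain ⟨Qs, hQs, hT, hQ⟩ := hg
  choose hP A hA using hP
  choose hQ B hB using hQ
  have : Finite Ps := hPs
  have : Finite Qs := hQs
  refine IsPiecewiseLinear.of_iUnion (ι := Ps × Qs)
    (fun i => i.1.1 ∩ A i.1.1 i.1.2 ⁻¹' i.2.1)
    (fun i => (B i.2.1 i.2.2).comp (A i.1.1 i.1.2))
    (fun i => (hP _ i.1.2).inter ((hQ _ i.2.2).preimage _)) ?_ ?_
  · ext x
    simp only [Set.mem_iUnion, Set.mem_inter_iff, Set.mem_preimage]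
    constructor
    · rintro ⟨i, hx, -⟩
      exact hS ▸ ⟨i.1.1, i.1.2, hx⟩
    · intro hx
      obtain ⟨P, hPm, hxP⟩ : x ∈ ⋃₀ Ps := hS ▸ hx
      obtain ⟨Q, hQm, hxQ⟩ : (f ⟨x, hx⟩ : F) ∈ ⋃₀ Qs := hT ▸ (f ⟨x, hx⟩).2
      refine ⟨⟨⟨P, hPm⟩, ⟨Q, hQm⟩⟩, hxP, ?_⟩
      rwa [← hA P hPm ⟨x, hx⟩ hxP]
  · rintro ⟨⟨P, hPm⟩, ⟨Q, hQm⟩⟩ x ⟨hxP, hxQ⟩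
    have h := hA P hPm x hxP
    have hxQ' : (f x : F) ∈ Q := by rw [h]; exact hxQ
    simp [hB Q hQm (f x) hxQ', h]

end Polyhedra

/-! ### PL homeomorphisms between realizations -/

section PLHomeomorphic

variable {α β γ : Type*} [Fintype α] [Fintype β] [Fintype γ]
  {K : PreAbstractSimplicialComplex α} {L : PreAbstractSimplicialComplex β}
  {M : PreAbstractSimplicialComplex γ}

theorem PLHomeomorphic.symm (h : PLHomeomorphic K L) : PLHomeomorphic L K :=
  let ⟨e, he, he'⟩ := h
  ⟨e.symm, he', he⟩

theorem PLHomeomorphic.trans (h : PLHomeomorphic K L) (h' : PLHomeomorphic L M) :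
    PLHomeomorphic K M :=
  let ⟨e, he, he'⟩ := h
  let ⟨d, hd, hd'⟩ := h'
  ⟨e.trans d, hd.comp he, he'.comp hd'⟩

/-- The face of the standard simplex spanned by `σ`. -/
def stdFace (σ : Finset α) : Set (α → ℝ) := {x | x ∈ stdSimplex ℝ α ∧ ∀ v, v ∉ σ → x v = 0}

theorem isConvexPolyhedron_stdFace (σ : Finset α) : IsConvexPolyhedron (stdFace σ) := by
  let c : α → (α → ℝ) →ᵃ[ℝ] ℝ := fun v => (LinearMap.proj v : (α → ℝ) →ₗ[ℝ] ℝ).toAffineMap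
  let s : (α → ℝ) →ᵃ[ℝ] ℝ :=
    (∑ v, LinearMap.proj v : (α → ℝ) →ₗ[ℝ] ℝ).toAffineMap - AffineMap.const ℝ _ 1
  have h1 := isConvexPolyhedron_setOf_forall c
  have h2 := isConvexPolyhedron_setOf_forall fun _ : Unit => s
  have h3 := isConvexPolyhedron_setOf_forall fun _ : Unit => -s
  have h4 := isConvexPolyhedron_setOf_forall fun v : {v // v ∉ σ} => -c v
  convert (h1.inter (h2.inter h3)).inter (h1.inter h4) using 1
  ext x
  simp only [stdFace, stdSimplex, Set.mem_ofPred_eq, Set.mem_inter_iff, c, s]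
  simp only [LinearMap.coe_toAffineMap, LinearMap.coe_proj, Function.eval, AffineMap.coe_sub,
    Pi.sub_apply, AffineMap.const_apply, AffineMap.coe_neg, Pi.neg_apply, LinearMap.coe_sum,
    Finset.sum_apply, forall_const, Subtype.forall]
  constructor
  · rintro ⟨⟨h, h'⟩, h''⟩
    exact ⟨⟨h, by linarith, by linarith⟩, h, fun v hv => by rw [h'' v hv]; simp⟩
  · rintro ⟨⟨h, h', h''⟩, -, h'''⟩
    exact ⟨⟨h, by linarith⟩, fun v hv => le_antisymm (by linarith [h''' v hv]) (h v)⟩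

theorem iUnion_stdFace (K : PreAbstractSimplicialComplex α) :
    ⋃ σ : K.faces, stdFace σ.1 = realization K := by
  ext x
  simp only [Set.mem_iUnion, stdFace, realization, Set.mem_ofPred_eq, Subtype.exists]
  constructor
  · rintro ⟨σ, hσ, hx, h⟩
    exact ⟨hx, σ, hσ, h⟩
  · rintro ⟨hx, σ, hσ, h⟩
    exact ⟨σ, hσ, hx, h⟩

theorem isPiecewiseLinear_of_linearMap {α β : Type*} [Fintype α]
    {K : PreAbstractSimplicialComplex α} {T : Set (β → ℝ)} (f : realization K → T)
    (A : (α → ℝ) →ₗ[ℝ] (β → ℝ)) (hf : ∀ x, (f x : β → ℝ) = A x) : IsPiecewiseLinear f :=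
  .of_iUnion (fun σ : K.faces => stdFace σ.1) (fun _ => A.toAffineMap)
    (fun σ => isConvexPolyhedron_stdFace σ.1) (iUnion_stdFace K) fun _ x _ => hf x

/-- Complexes that differ by an injective relabelling of the vertices are PL homeomorphic. -/
theorem plHomeomorphic_of_map (g : α ↪ β)
    (h : ∀ τ, τ ∈ L.faces ↔ ∃ ρ ∈ K.faces, ρ.map g = τ) : PLHomeomorphic K L := by
  classical
  -- Extension by zero and restriction along `g`. They are mutually inverse although `g` need not be
  -- onto: each simplex of `L` is an image under `g`, so points of |L| vanish off its range.
  let A : (α → ℝ) →ₗ[ℝ] (β → ℝ) := Function.ExtendByZero.linearMap ℝ g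
  let B : (β → ℝ) →ₗ[ℝ] (α → ℝ) := LinearMap.funLeft ℝ ℝ g
  have hAg (x : α → ℝ) (i : α) : A x (g i) = x i := g.injective.extend_apply x (0 : β → ℝ) i
  have hA0 (x : α → ℝ) (j : β) (hj : ¬∃ i, g i = j) : A x j = 0 :=
    Function.extend_apply' x (0 : β → ℝ) j hj
  have hsum (y : β → ℝ) (hy : ∀ j, (¬∃ i, g i = j) → y j = 0) : ∑ j, y j = ∑ i, y (g i) := by
    rw [← Finset.sum_map Finset.univ g y]
    refine (Finset.sum_subset (Finset.subset_univ _) fun j _ hj => hy j ?_).symm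
    simpa using hj
  have hA (x : realization K) : A x ∈ realization L := by
    obtain ⟨x, ⟨hx0, hx1⟩, σ, hσ, hx⟩ := x
    refine ⟨⟨fun j => ?_, ?_⟩, σ.map g, (h _).2 ⟨σ, hσ, rfl⟩, fun j hj => ?_⟩
    · by_cases hj : ∃ i, g i = j
      · obtain ⟨i, rfl⟩ := hj
        exact (hAg x i).symm ▸ hx0 i
      · exact (hA0 x j hj).ge
    · rw [hsum _ (hA0 x)]
      simpa only [hAg] using hx1
    · by_cases hj' : ∃ i, g i = j
      · obtain ⟨i, rfl⟩ := hj'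
        exact (hAg x i).trans (hx i (by simpa using hj))
      · exact hA0 x j hj'
  have hL0 (y : realization L) (j : β) (hj : ¬∃ i, g i = j) : (y : β → ℝ) j = 0 := by
    obtain ⟨y, -, τ, hτ, hy⟩ := y
    obtain ⟨ρ, -, rfl⟩ := (h _).1 hτ
    exact hy j fun hj' => hj (by
      obtain ⟨i, -, hi⟩ := Finset.mem_map.1 hj'
      exact ⟨i, hi⟩)
  have hB (y : realization L) : B y ∈ realization K := by
    have h0 := hL0 y
    obtain ⟨y, ⟨hy0, hy1⟩, τ, hτ, hy⟩ := y
    obtain ⟨ρ, hρ, rfl⟩ := (h _).1 hτ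
    refine ⟨⟨fun i => hy0 _, ?_⟩, ρ, hρ, fun i hi => hy _ (by simpa using hi)⟩
    exact (hsum y h0).symm.trans hy1
  let e : realization K ≃ₜ realization L :=
    { toFun := fun x => ⟨A x, hA x⟩
      invFun := fun y => ⟨B y, hB y⟩
      left_inv := fun x => Subtype.ext (funext fun i => hAg x i)
      right_inv := fun y => Subtype.ext (funext fun j => by
        by_cases hj : ∃ i, g i = j
        · obtain ⟨i, rfl⟩ := hj
          exact hAg _ i
        · exact (hA0 _ j hj).trans (hL0 y j hj).symm)
      continuous_toFun := by
        exact (A.continuous_of_finiteDimensional.comp continuous_subtype_val).subtype_mk _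
      continuous_invFun := by
        exact (B.continuous_of_finiteDimensional.comp continuous_subtype_val).subtype_mk _ }
  exact ⟨e, isPiecewiseLinear_of_linearMap _ A fun _ => rfl,
    isPiecewiseLinear_of_linearMap _ B fun _ => rfl⟩

end PLHomeomorphic

/-! ### Stellar subdivision preserves the PL type -/

section Stellar

variable {α : Type*} [DecidableEq α]

/-- The stellar subdivision of `K` at the simplex `σ`, with new vertex `v`. -/
def stellarSubdivision (K : PreAbstractSimplicialComplex α) (σ : Finset α) (v : α) :
    PreAbstractSimplicialComplex α where
  faces := {τ | τ.Nonempty ∧ ¬σ ⊆ τ ∧ (v ∉ τ → τ ∈ K.faces) ∧ (v ∈ τ → τ.erase v ∪ σ ∈ K.faces)}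
  isRelLowerSet_faces := by
    rintro τ ⟨hτ, hσ, h1, h2⟩
    refine ⟨hτ, fun ρ hρ hne => ⟨hne, fun h => hσ (h.trans hρ), fun hv => ?_, fun hv => ?_⟩⟩
    · by_cases hvτ : v ∈ τ
      · refine (K.isRelLowerSet_faces (h2 hvτ)).2 (fun i hi => ?_) hne
        exact Finset.mem_union_left _ (Finset.mem_erase.2 ⟨fun h => hv (h ▸ hi), hρ hi⟩)
      · exact (K.isRelLowerSet_faces (h1 hvτ)).2 hρ hne
    · have h := h2 (hρ hv)
      refine (K.isRelLowerSet_faces h).2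
        (Finset.union_subset_union_left (Finset.erase_subset_erase v hρ)) ?_
      obtain ⟨i, hi, -⟩ := Finset.not_subset.1 hσ
      exact ⟨i, Finset.mem_union_right _ hi⟩

/-- A stellar subdivision of a complex is PL homeomorphic to it. -/
theorem plHomeomorphic_stellarSubdivision [Fintype α] (K : PreAbstractSimplicialComplex α)
    {σ : Finset α} {v : α} (hσ : σ.Nonempty) (hvσ : v ∉ σ) (hK : ∀ τ ∈ K.faces, v ∉ τ) :
    PLHomeomorphic (stellarSubdivision K σ v) K := by
  have hc : (0 : ℝ) < σ.card := by exact_mod_cast hσ.card_pos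
  let u : α → ℝ := fun i => if i ∈ σ then 1 else 0
  let d : α → ℝ := fun i => if i = v then 1 else 0
  have hu : ∑ i, u i = σ.card := by simp [u]
  have hd : ∑ i, d i = 1 := by simp [d]
  -- `S` sends the basis vector of `v` to the barycentre of `σ` and fixes the other basis vectors.
  let S : (α → ℝ) →ₗ[ℝ] (α → ℝ) :=
    LinearMap.id + (LinearMap.proj v : (α → ℝ) →ₗ[ℝ] ℝ).smulRight ((σ.card : ℝ)⁻¹ • u - d)
  let T : α → (α → ℝ) →ₗ[ℝ] (α → ℝ) := fun j =>
    LinearMap.id + (LinearMap.proj j : (α → ℝ) →ₗ[ℝ] ℝ).smulRight ((σ.card : ℝ) • d - u)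
  have hS (x : α → ℝ) (i : α) : S x i = x i + x v * ((σ.card : ℝ)⁻¹ * u i - d i) := rfl
  have hT (j : α) (x : α → ℝ) (i : α) : T j x i = x i + x j * (σ.card * d i - u i) := rfl
  -- The inverse `R` takes the minimum `m` away from every coordinate in `σ` and gives the total,
  -- |σ|·m, to `v`. Where coordinate `j` is minimal it is the linear map `T j`.
  let m : (α → ℝ) → ℝ := fun x => σ.inf' hσ x
  let R : (α → ℝ) → α → ℝ := fun x i => x i + m x * (σ.card * d i - u i)
  have hR (x : α → ℝ) (j : α) (hj : j ∈ σ) (h : ∀ i ∈ σ, x j ≤ x i) : R x = T j x := by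
    have : m x = x j := le_antisymm (Finset.inf'_le _ hj) ((Finset.le_inf'_iff _ _).2 h)
    ext i
    simp only [R, hT, this]
  have hmin (x : α → ℝ) : ∃ j ∈ σ, ∀ i ∈ σ, x j ≤ x i := σ.exists_min_image x hσ
  have huv : u v = 0 := if_neg hvσ
  have hdv : d v = 1 := if_pos rfl
  have hd0 (i : α) (hi : i ≠ v) : d i = 0 := if_neg hi
  have hu0 (i : α) (hi : i ∉ σ) : u i = 0 := if_neg hi
  have hu1 (i : α) (hi : i ∈ σ) : u i = 1 := if_pos hi
  have hune (i : α) : 0 ≤ u i := by simp only [u]; split_ifs <;> norm_num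
  have hσv (i : α) (hi : i ∈ σ) : i ≠ v := fun h => hvσ (h ▸ hi)
  have hKv (x : realization K) : (x : α → ℝ) v = 0 := by
    obtain ⟨x, -, τ, hτ, hx⟩ := x
    exact hx v (hK τ hτ)
  have hSmem (x : realization (stellarSubdivision K σ v)) : S x ∈ realization K := by
    obtain ⟨x, ⟨hx0, hx1⟩, τ, ⟨hτ, hστ, h1, h2⟩, hx⟩ := x
    refine ⟨⟨fun i => ?_, ?_⟩, ?_⟩
    · by_cases hi : i = v
      · subst hi
        simp [hS, huv, hdv]
      · rw [hS, hd0 i hi, sub_zero]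
        have := hx0 i; have := hx0 v; have := hune i
        positivity
    · simp only [hS, Finset.sum_add_distrib, ← Finset.mul_sum, Finset.sum_sub_distrib, hu, hd]
      rw [inv_mul_cancel₀ hc.ne']
      simpa using hx1
    · by_cases hv : v ∈ τ
      · refine ⟨_, h2 hv, fun i hi => ?_⟩
        simp only [Finset.mem_union, Finset.mem_erase, not_or, not_and] at hi
        by_cases hiv : i = v
        · subst hiv
          simp [hS, huv, hdv]
        · simp [hS, hd0 i hiv, hu0 i hi.2, hx i (hi.1 hiv)]
      · refine ⟨τ, h1 hv, fun i hi => ?_⟩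
        simp [hS, hx v hv, hx i hi]
  have hRmem (y : realization K) : R y ∈ realization (stellarSubdivision K σ v) := by
    have hyv := hKv y
    obtain ⟨y, ⟨hy0, hy1⟩, ρ, hρ, hy⟩ := y
    obtain ⟨j, hj, hjm⟩ := hmin y
    simp only at hyv ⊢
    rw [hR y j hj hjm]
    refine ⟨⟨fun i => ?_, ?_⟩, ?_⟩
    · by_cases hi : i = v
      · subst hi
        simp only [hT, hyv, hdv, huv, mul_one, sub_zero, zero_add]
        exact mul_nonneg (hy0 j) hc.le
      · rw [hT, hd0 i hi]
        by_cases hiσ : i ∈ σ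
        · rw [hu1 i hiσ]
          linarith [hjm i hiσ]
        · simpa [hu0 i hiσ] using hy0 i
    · simp only [hT, Finset.sum_add_distrib, ← Finset.mul_sum, Finset.sum_sub_distrib, hu, hd]
      simpa using hy1
    -- If the minimum is zero, the point is unmoved and dropping `j` from `ρ` gives a simplex not
    -- containing `σ`. Otherwise `σ ⊆ ρ`, and the carrier is `ρ` with `j` replaced by `v`.
    · by_cases hyj : y j = 0
      · have hpos : ∃ i, y i ≠ 0 := by
          by_contra! h
          simp [h] at hy1
        obtain ⟨i, hi⟩ := hpos
        have hiρ : i ∈ ρ := by by_contra h; exact hi (hy i h)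
        have hij : i ≠ j := fun h => hi (h ▸ hyj)
        have hsub : ρ.erase j ⊆ ρ := Finset.erase_subset _ _
        have hin : (ρ.erase j).Nonempty := ⟨i, Finset.mem_erase.2 ⟨hij, hiρ⟩⟩
        refine ⟨ρ.erase j, ⟨hin, fun h => (Finset.mem_erase.1 (h hj)).1 rfl,
          fun _ => (K.isRelLowerSet_faces hρ).2 hsub hin,
          fun h => (hK ρ hρ (hsub h)).elim⟩, fun k hk => ?_⟩
        rw [hT, hyj, zero_mul, add_zero]
        by_cases hkj : k = j
        · rw [hkj, hyj]
        · exact hy k fun h => hk (Finset.mem_erase.2 ⟨hkj, h⟩)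
      · have hσρ : σ ⊆ ρ := fun i hi => by
          by_contra h
          exact hyj (le_antisymm (hy i h ▸ hjm i hi) (hy0 j))
        have hvρ := hK ρ hρ
        refine ⟨insert v (ρ.erase j), ⟨Finset.insert_nonempty _ _, fun h => ?_,
          fun h => (h (Finset.mem_insert_self _ _)).elim, fun _ => ?_⟩, fun k hk => ?_⟩
        · have := h hj
          simp [hσv j hj] at this
        · rw [Finset.erase_insert (fun h => hvρ (Finset.mem_of_mem_erase h))]
          convert hρ
          ext k
          simp only [Finset.mem_union, Finset.mem_erase]
          by_cases hkj : k = j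
          · simp [hkj, hj, hσρ hj]
          · have := @hσρ k
            tauto
        · simp only [Finset.mem_insert, Finset.mem_erase, not_or, not_and] at hk
          rw [hT, hd0 k hk.1]
          by_cases hkj : k = j
          · rw [hkj, hu1 j hj]; ring
          · have hkρ := hk.2 hkj
            rw [hy k hkρ, hu0 k fun h => hkρ (hσρ h)]; ring
  have hRS (x : realization (stellarSubdivision K σ v)) : R (S x) = x := by
    obtain ⟨x, ⟨hx0, hx1⟩, τ, ⟨hτ, hστ, h1, h2⟩, hx⟩ := x
    -- Since `τ` misses some `j ∈ σ`, coordinate `j` of `x` is zero, so after `S` it attains the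
    -- minimum over `σ`, namely `x v / |σ|`.
    obtain ⟨j, hj, hjτ⟩ := Finset.not_subset.1 hστ
    have hSσ (i : α) (hi : i ∈ σ) : S x i = x i + x v * (σ.card : ℝ)⁻¹ := by
      simp [hS, hu1 i hi, hd0 i (hσv i hi)]
    have hxj := hx j hjτ
    simp only
    rw [hR _ j hj fun i hi => by rw [hSσ i hi, hSσ j hj, hxj]; linarith [hx0 i]]
    ext i
    rw [hT, hSσ j hj, hS, hxj]
    field_simp
    ring
  have hSR (y : realization K) : S (R y) = y := by
    have hyv := hKv y
    obtain ⟨j, hj, hjm⟩ := hmin y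
    rw [hR _ j hj hjm]
    ext i
    rw [hS, hT, hT, hyv, hdv, huv]
    field_simp
    ring
  have hRcont : Continuous R := by
    have hm : Continuous m :=
      Continuous.finset_inf'_apply hσ fun i _ => continuous_apply i
    exact continuous_pi fun i => (continuous_apply i).add (hm.mul continuous_const)
  let e : realization (stellarSubdivision K σ v) ≃ₜ realization K :=
    { toFun := fun x => ⟨S x, hSmem x⟩
      invFun := fun y => ⟨R y, hRmem y⟩
      left_inv := fun x => Subtype.ext (hRS x)
      right_inv := fun y => Subtype.ext (hSR y)
      continuous_toFun := by
        exact (S.continuous_of_finiteDimensional.comp continuous_subtype_val).subtype_mk _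
      continuous_invFun := by
        exact (hRcont.comp continuous_subtype_val).subtype_mk _ }
  refine ⟨e, isPiecewiseLinear_of_linearMap _ S fun _ => rfl, ?_⟩
  let c : α → (α → ℝ) →ᵃ[ℝ] ℝ := fun v => (LinearMap.proj v : (α → ℝ) →ₗ[ℝ] ℝ).toAffineMap
  refine IsPiecewiseLinear.of_iUnion (ι := K.faces × σ)
    (fun p => stdFace p.1.1 ∩ {x | ∀ i : σ, 0 ≤ (c i - c p.2) x})
    (fun p => (T p.2).toAffineMap)
    (fun p => (isConvexPolyhedron_stdFace _).inter (isConvexPolyhedron_setOf_forall _)) ?_ ?_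
  · rw [← iUnion_stdFace]
    ext x
    simp only [Set.mem_iUnion, Set.mem_inter_iff]
    constructor
    · rintro ⟨p, hp, -⟩
      exact ⟨p.1, hp⟩
    · rintro ⟨ρ, hρ⟩
      obtain ⟨j, hj, hjm⟩ := hmin x
      exact ⟨⟨ρ, ⟨j, hj⟩⟩, hρ, fun i => sub_nonneg.2 (hjm i i.2)⟩
  · rintro ⟨ρ, ⟨j, hj⟩⟩ y ⟨-, hy⟩
    exact hR y j hj fun i hi => sub_nonneg.1 (hy ⟨i, hi⟩)

end Stellar

/-! ### Facet lists and weld certificates -/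

section Facets

variable {α : Type*}

/-- The complex whose simplices are the nonempty subsets of the members of `F`. -/
def ofFacets (F : Finset (Finset α)) : PreAbstractSimplicialComplex α where
  faces := {τ | τ.Nonempty ∧ ∃ f ∈ F, τ ⊆ f}
  isRelLowerSet_faces := by
    rintro τ ⟨hτ, f, hf, h⟩
    exact ⟨hτ, fun ρ hρ hne => ⟨hne, f, hf, hρ.trans h⟩⟩

theorem mem_ofFacets {F : Finset (Finset α)} {τ : Finset α} :
    τ ∈ (ofFacets F).faces ↔ τ.Nonempty ∧ ∃ f ∈ F, τ ⊆ f := Iff.rfl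

variable [DecidableEq α]

/-- The facets of the stellar subdivision at `σ` with new vertex `v`. -/
def stellarFacets (F : Finset (Finset α)) (σ : Finset α) (v : α) : Finset (Finset α) :=
  F.biUnion fun f => if σ ⊆ f then σ.image fun i => insert v (f.erase i) else {f}

theorem stellarSubdivision_ofFacets {F : Finset (Finset α)} {σ : Finset α} {v : α}
    (hvσ : v ∉ σ) (hF : ∀ f ∈ F, v ∉ f) :
    stellarSubdivision (ofFacets F) σ v = ofFacets (stellarFacets F σ v) := by
  ext τ
  constructor
  · rintro ⟨hne, hστ, h1, h2⟩
    obtain ⟨i, hi, hiτ⟩ := Finset.not_subset.1 hστ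
    -- One facet serves both cases: it contains `τ` without `v`, and also `σ` when `v ∈ τ`.
    obtain ⟨f, hf, hτf⟩ : ∃ f ∈ F, τ.erase v ⊆ f ∧ (v ∈ τ → σ ⊆ f) := by
      by_cases hv : v ∈ τ
      · obtain ⟨-, f, hf, h⟩ := h2 hv
        exact ⟨f, hf, Finset.union_subset_left h, fun _ => Finset.union_subset_right h⟩
      · obtain ⟨-, f, hf, h⟩ := h1 hv
        exact ⟨f, hf, (Finset.erase_subset _ _).trans h, fun h => (hv h).elim⟩
    refine ⟨hne, ?_⟩
    by_cases hσf : σ ⊆ f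
    · refine ⟨insert v (f.erase i), Finset.mem_biUnion.2 ⟨f, hf, ?_⟩, fun k hk => ?_⟩
      · rw [if_pos hσf]
        exact Finset.mem_image_of_mem _ hi
      · by_cases hkv : k = v
        · exact hkv ▸ Finset.mem_insert_self _ _
        · exact Finset.mem_insert_of_mem (Finset.mem_erase.2
            ⟨fun h => hiτ (h ▸ hk), hτf.1 (Finset.mem_erase.2 ⟨hkv, hk⟩)⟩)
    · refine ⟨f, Finset.mem_biUnion.2 ⟨f, hf, ?_⟩, fun k hk => ?_⟩
      · rw [if_neg hσf]
        exact Finset.mem_singleton_self f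
      · exact hτf.1 (Finset.mem_erase.2 ⟨fun h => hσf (hτf.2 (h ▸ hk)), hk⟩)
  · rintro ⟨hne, g, hg, hτg⟩
    obtain ⟨f, hf, hg⟩ := Finset.mem_biUnion.1 hg
    have hvf := hF f hf
    split_ifs at hg with hσf
    · obtain ⟨i, hi, rfl⟩ := Finset.mem_image.1 hg
      have hiv : i ≠ v := fun h => hvσ (h ▸ hi)
      have hsub : τ.erase v ⊆ f := fun k hk => by
        have h := hτg (Finset.mem_of_mem_erase hk)
        rw [Finset.mem_insert, or_iff_right (Finset.ne_of_mem_erase hk)] at h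
        exact Finset.mem_of_mem_erase h
      refine ⟨hne, fun h => ?_, fun hv => ?_, fun hv => ?_⟩
      · simpa [hiv] using hτg (h hi)
      · exact ⟨hne, f, hf, by rwa [Finset.erase_eq_of_notMem hv] at hsub⟩
      · exact ⟨⟨i, Finset.mem_union_right _ hi⟩, f, hf, Finset.union_subset hsub hσf⟩
    · rw [Finset.mem_singleton] at hg
      subst hg
      exact ⟨hne, fun h => hσf (h.trans hτg), fun _ => ⟨hne, g, hf, hτg⟩,
        fun hv => (hvf (hτg hv)).elim⟩

/-- The facets of the complex obtained by undoing a stellar subdivision at `σ` whose new vertex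
was `v`. -/
def weldFacets (F : Finset (Finset α)) (v : α) (σ : Finset α) : Finset (Finset α) :=
  F.image fun f => if v ∈ f then f.erase v ∪ σ else f

/-- Whether the list of stellar welds `l` takes the complex with facets `F` to the boundary of a
simplex with `k` vertices. -/
def weldsToSphere (k : ℕ) : List (α × Finset α) → Finset (Finset α) → Bool
  | [], F => decide ((F.sup id).card = k ∧ F = (F.sup id).image (F.sup id).erase)
  | (v, σ) :: l, F =>
    decide (σ.Nonempty ∧ v ∉ σ ∧ (∀ f ∈ weldFacets F v σ, v ∉ f) ∧
      stellarFacets (weldFacets F v σ) σ v = F) && weldsToSphere k l (weldFacets F v σ)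

theorem isCombinatorialSphere_image_erase [Fintype α] {n : ℕ} {s : Finset α}
    (hs : s.card = n + 2) : IsCombinatorialSphere n (ofFacets (s.image s.erase)) := by
  let e : Fin (n + 2) ≃ s := (Fintype.equivFinOfCardEq (by simpa using hs)).symm
  let g : Fin (n + 2) ↪ α := e.toEmbedding.trans (Function.Embedding.subtype (· ∈ s))
  have hg (i : α) (hi : i ∈ s) : ∃ j, g j = i := ⟨e.symm ⟨i, hi⟩, by simp [g]⟩
  have hgs (j : Fin (n + 2)) : g j ∈ s := (e j).2
  refine (plHomeomorphic_of_map g fun τ => ?_).symm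
  rw [mem_ofFacets]
  constructor
  · rintro ⟨hne, f, hf, hτ⟩
    obtain ⟨i, hi, rfl⟩ := Finset.mem_image.1 hf
    have hτg : (Finset.univ.filter fun j => g j ∈ τ).map g = τ := by
      ext k
      simp only [Finset.mem_map, Finset.mem_filter, Finset.mem_univ, true_and]
      constructor
      · rintro ⟨j, hj, rfl⟩
        exact hj
      · intro hk
        obtain ⟨j, rfl⟩ := hg k (Finset.mem_of_mem_erase (hτ hk))
        exact ⟨j, hk, rfl⟩
    refine ⟨_, ⟨?_, fun h => ?_⟩, hτg⟩
    · rwa [← Finset.map_nonempty (f := g), hτg]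
    · obtain ⟨j, rfl⟩ := hg i hi
      have hj := Finset.eq_univ_iff_forall.1 h j
      exact Finset.notMem_erase _ _ (hτ (Finset.mem_filter.1 hj).2)
  · rintro ⟨ρ, ⟨hne, hρ⟩, rfl⟩
    obtain ⟨j, hj⟩ : ∃ j, j ∉ ρ := by
      by_contra! h
      exact hρ (Finset.eq_univ_iff_forall.2 h)
    refine ⟨hne.map, _, Finset.mem_image_of_mem _ (hgs j), fun k hk => ?_⟩
    obtain ⟨i, hi, rfl⟩ := Finset.mem_map.1 hk
    exact Finset.mem_erase.2 ⟨fun h => hj (g.injective h ▸ hi), hgs i⟩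

/-- The check re-subdivides each welded facet list and compares it with the original, so no theory
of when a weld is legitimate is needed. -/
theorem isCombinatorialSphere_of_weldsToSphere [Fintype α] {n : ℕ} (l : List (α × Finset α))
    {F : Finset (Finset α)} (h : weldsToSphere (n + 2) l F = true) :
    IsCombinatorialSphere n (ofFacets F) := by
  induction l generalizing F with
  | nil =>
    obtain ⟨h1, h2⟩ := of_decide_eq_true h
    rw [h2]
    exact isCombinatorialSphere_image_erase h1
  | cons p l ih =>
    obtain ⟨v, σ⟩ := p
    simp only [weldsToSphere, Bool.and_eq_true, decide_eq_true_eq] at h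
    obtain ⟨⟨hσ, hvσ, hv, hF⟩, hl⟩ := h
    have hK := plHomeomorphic_stellarSubdivision (ofFacets (weldFacets F v σ)) hσ hvσ
      fun τ ⟨_, f, hf, hτ⟩ hvτ => hv f hf (hτ hvτ)
    rw [stellarSubdivision_ofFacets hvσ hv, hF] at hK
    exact hK.trans (ih hl)

end Facets

/-! ### A computable model of `X` on `Fin 15` -/

/-- The non-trivial elements of the Klein four group. -/
def involution : Fin 3 → {ν : Equiv.Perm (Fin 4) // ν ∈ kleinFour ∧ ν ≠ 1} :=
  ![⟨Equiv.swap 0 1 * Equiv.swap 2 3, by decide⟩, ⟨Equiv.swap 0 2 * Equiv.swap 1 3, by decide⟩,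
    ⟨Equiv.swap 0 3 * Equiv.swap 1 2, by decide⟩]

/-- The action of `involution` on the four letters. -/
def partner : Fin 3 → Fin 4 → Fin 4 := ![![1, 0, 3, 2], ![2, 3, 0, 1], ![3, 2, 1, 0]]

theorem involution_apply : ∀ n a, (involution n).1 a = partner n a := by decide

theorem involution_injective : Function.Injective involution := by
  intro m n h
  -- The image of the first letter already tells the three involutions apart.
  have h' : partner m 0 = partner n 0 := by
    rw [← involution_apply, ← involution_apply, h]
  revert h'
  revert m n
  decide

theorem involution_surjective : Function.Surjective involution := by
  rintro ⟨ν, hν, h1⟩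
  simp only [kleinFour, Finset.mem_insert, Finset.mem_singleton] at hν
  rcases hν with rfl | rfl | rfl | rfl
  · exact (h1 rfl).elim
  · exact ⟨0, rfl⟩
  · exact ⟨1, rfl⟩
  · exact ⟨2, rfl⟩

/-- The vertices of `X`, numbered. -/
noncomputable def numbering : XVertex ≃ Fin 15 :=
  (Equiv.sumCongr (Equiv.ofBijective _ ⟨involution_injective, involution_surjective⟩).symm
    finProdFinEquiv).trans finSumFinEquiv

theorem numbering_inl (n : Fin 3) : numbering (Sum.inl (involution n)) = Fin.castAdd 12 n := by
  have : (Equiv.ofBijective _ ⟨involution_injective, involution_surjective⟩).symm (involution n)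
      = n := Equiv.ofBijective_symm_apply_apply _ _ n
  simp only [numbering, Equiv.trans_apply, Equiv.sumCongr_apply, Sum.map_inl, this]
  rfl

/-- The numbered version of the facets of `X`. -/
def numberedFacet (n : Fin 3) (b : Fin 4 → Fin 3) : Finset (Fin 15) :=
  insert (Fin.castAdd 12 n) (Finset.univ.image fun a => Fin.natAdd 3 (finProdFinEquiv (a, b a)))

theorem map_facet (n : Fin 3) (b : Fin 4 → Fin 3) :
    (facet (involution n) b).map numbering.toEmbedding = numberedFacet n b := by
  rw [Finset.map_eq_image, facet, numberedFacet, Finset.image_insert, Finset.image_image]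
  simp only [Equiv.coe_toEmbedding, numbering_inl]
  congr 1

/-- The facets of `X`, with numbered vertices. -/
def numberedFacets : Finset (Finset (Fin 15)) :=
  ((Finset.univ : Finset (Fin 3 × (Fin 3 × Fin 3 × Fin 3 × Fin 3))).filter fun p =>
    ∀ a, ![p.2.1, p.2.2.1, p.2.2.2.1, p.2.2.2.2] (partner p.1 a) ≠
      ![p.2.1, p.2.2.1, p.2.2.2.1, p.2.2.2.2] a).image
    fun p => numberedFacet p.1 ![p.2.1, p.2.2.1, p.2.2.2.1, p.2.2.2.2]

theorem mem_numberedFacets {f : Finset (Fin 15)} : f ∈ numberedFacets ↔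
    ∃ n b, (∀ a, b (partner n a) ≠ b a) ∧ numberedFacet n b = f := by
  simp only [numberedFacets, Finset.mem_image, Finset.mem_filter, Finset.mem_univ, true_and]
  constructor
  · rintro ⟨p, hp, rfl⟩
    exact ⟨_, _, hp, rfl⟩
  · rintro ⟨n, b, hb, rfl⟩
    have h : ![b 0, b 1, b 2, b 3] = b := by
      ext a
      fin_cases a <;> rfl
    refine ⟨(n, b 0, b 1, b 2, b 3), ?_, ?_⟩
    · simpa only [h] using hb
    · simp only [h]

/-- Confines the noncomputable `numbering` to membership statements, leaving explicit facet lists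
that can be evaluated. -/
theorem mem_X_iff {τ : Finset XVertex} : τ ∈ X.faces ↔
    τ.Nonempty ∧ ∃ f ∈ numberedFacets, τ.map numbering.toEmbedding ⊆ f := by
  refine and_congr_right fun _ => ?_
  constructor
  · rintro ⟨ν, b, hb, hτ⟩
    obtain ⟨n, rfl⟩ := involution_surjective ν
    refine ⟨_, mem_numberedFacets.2 ⟨n, b, fun a => ?_, rfl⟩, ?_⟩
    · rw [← involution_apply]
      exact hb a
    · rw [← map_facet]
      exact Finset.map_subset_map.2 hτ
  · rintro ⟨f, hf, hτ⟩
    obtain ⟨n, b, hb, rfl⟩ := mem_numberedFacets.1 hf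
    refine ⟨involution n, b, fun a => ?_, ?_⟩
    · rw [involution_apply]
      exact hb a
    · rw [← map_facet] at hτ
      exact Finset.map_subset_map.1 hτ

/-- The facets of the link of a vertex of `X`, with numbered vertices. -/
def linkFacets (i : Fin 15) : Finset (Finset (Fin 15)) :=
  (numberedFacets.filter (i ∈ ·)).image (·.erase i)

theorem mem_link_iff {v : XVertex} {τ : Finset XVertex} : τ ∈ (link X {v}).faces ↔
    τ.map numbering.toEmbedding ∈ (ofFacets (linkFacets (numbering v))).faces := by
  rw [mem_ofFacets, Finset.map_nonempty]
  refine and_congr_right fun _ => ?_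
  rw [mem_X_iff, ← Finset.disjoint_iff_inter_eq_empty, Finset.disjoint_singleton_right]
  simp only [linkFacets, Finset.mem_image, Finset.mem_filter]
  have hv : numbering v ∈ τ.map numbering.toEmbedding ↔ v ∈ τ :=
    Finset.mem_map' numbering.toEmbedding
  constructor
  · rintro ⟨hvτ, -, f, hf, hτ⟩
    rw [Finset.map_union, Finset.map_singleton, Finset.union_subset_iff,
      Finset.singleton_subset_iff] at hτ
    exact ⟨_, ⟨f, ⟨hf, hτ.2⟩, rfl⟩, Finset.subset_erase.2 ⟨hτ.1, mt hv.1 hvτ⟩⟩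
  · rintro ⟨_, ⟨f, ⟨hf, hvf⟩, rfl⟩, hτ⟩
    obtain ⟨hτ, hvτ⟩ := Finset.subset_erase.1 hτ
    refine ⟨mt hv.2 hvτ, ⟨v, by simp⟩, f, hf, ?_⟩
    rw [Finset.map_union, Finset.map_singleton, Finset.union_subset_iff,
      Finset.singleton_subset_iff]
    exact ⟨hτ, hvf⟩

theorem plHomeomorphic_link (v : XVertex) :
    PLHomeomorphic (link X {v}) (ofFacets (linkFacets (numbering v))) := by
  refine plHomeomorphic_of_map numbering.toEmbedding fun τ => ?_
  simp only [mem_link_iff]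
  constructor
  · intro hτ
    have h : (τ.map numbering.symm.toEmbedding).map numbering.toEmbedding = τ := by
      simp [Finset.map_map]
    exact ⟨_, by rwa [h], h⟩
  · rintro ⟨ρ, hρ, rfl⟩
    exact hρ

/-! ### The vertex links are spheres -/

/-- Stellar welds that take the link of each vertex of `X` to the boundary of a simplex. -/
def linkWelds : Fin 15 → List (Fin 15 × Finset (Fin 15)) :=
  ![
    [(3, {7, 8}), (4, {6, 8}), (5, {6, 7}), (9, {13, 14}),
      (10, {12, 14}), (6, {11, 14}), (7, {12, 13})],
    [(3, {10, 11}), (4, {9, 11}), (5, {9, 10}), (6, {13, 14}),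
      (7, {12, 14}), (8, {12, 13}), (9, {12, 13, 14})],
    [(3, {13, 14}), (4, {12, 14}), (5, {12, 13}), (6, {10, 11}),
      (7, {9, 11}), (8, {9, 10}), (9, {12, 13, 14})],
    [(0, {7, 8}), (1, {10, 11}), (2, {13, 14}), (6, {10, 11, 13, 14}),
      (9, {7, 8, 13, 14}), (12, {7, 8, 10, 11}), (7, {8, 11, 14})],
    [(0, {6, 8}), (1, {9, 11}), (2, {12, 14}), (7, {9, 11, 12, 14}),
      (10, {6, 8, 12, 14}), (12, {8, 11, 14}), (6, {13, 14})],
    [(0, {6, 7}), (1, {9, 10}), (2, {12, 13}), (8, {9, 10, 12, 13}),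
      (11, {6, 7, 12, 13}), (12, {7, 10, 13}), (6, {13, 14})],
    [(0, {4, 5}), (1, {13, 14}), (2, {10, 11}), (3, {10, 11, 13, 14}),
      (9, {4, 5, 13, 14}), (12, {4, 5, 10, 11}), (4, {5, 11, 14})],
    [(0, {3, 5}), (1, {12, 14}), (2, {9, 11}), (4, {9, 11, 12, 14}),
      (10, {3, 5, 12, 14}), (12, {5, 11, 14}), (3, {13, 14})],
    [(0, {3, 4}), (1, {12, 13}), (2, {9, 10}), (5, {9, 10, 12, 13}),
      (11, {3, 4, 12, 13}), (12, {4, 10, 13}), (3, {13, 14})],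
    [(0, {13, 14}), (1, {4, 5}), (2, {7, 8}), (3, {7, 8, 13, 14}),
      (6, {4, 5, 13, 14}), (12, {4, 5, 7, 8}), (4, {5, 8, 14})],
    [(0, {12, 14}), (1, {3, 5}), (2, {6, 8}), (4, {6, 8, 12, 14}),
      (7, {3, 5, 12, 14}), (12, {5, 8, 14}), (3, {13, 14})],
    [(0, {12, 13}), (1, {3, 4}), (2, {6, 7}), (5, {6, 7, 12, 13}),
      (8, {3, 4, 12, 13}), (12, {4, 7, 13}), (3, {13, 14})],
    [(0, {10, 11}), (1, {7, 8}), (2, {4, 5}), (3, {7, 8, 10, 11}),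
      (6, {4, 5, 10, 11}), (9, {4, 5, 7, 8}), (4, {5, 8, 11})],
    [(0, {9, 11}), (1, {6, 8}), (2, {3, 5}), (4, {6, 8, 9, 11}),
      (7, {3, 5, 9, 11}), (9, {5, 8, 11}), (3, {10, 11})],
    [(0, {9, 10}), (1, {6, 7}), (2, {3, 4}), (5, {6, 7, 9, 10}),
      (8, {3, 4, 9, 10}), (9, {4, 7, 10}), (3, {10, 11})]]

/-- For a vertex (a, b) the first three welds remove the involutions: ν goes with the edge on the
two vertices (ν(a), b') with b' ≠ b. For an involution the welds start by shrinking one hexagon to a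
triangle. -/
theorem weldsToSphere_linkWelds : ∀ i, weldsToSphere 5 (linkWelds i) (linkFacets i) = true := by
  decide +kernel

theorem isCombinatorialManifold_X : IsCombinatorialManifold 4 X := fun v _ =>
  (plHomeomorphic_link v).trans
    (isCombinatorialSphere_of_weldsToSphere _ (weldsToSphere_linkWelds (numbering v)))

/-! ### The link of (12)(34) as a join of hexagons -/

theorem isomorphic_of_map {α β : Type*} {K : PreAbstractSimplicialComplex α}
    {L : PreAbstractSimplicialComplex β} (g : β ↪ α)
    (h : ∀ τ, τ ∈ K.faces ↔ ∃ ρ ∈ L.faces, ρ.map g = τ) : Isomorphic K L := by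
  let f : vertices L → vertices K := fun v => ⟨g v, (h _).2 ⟨{v.1}, v.2, Finset.map_singleton _ _⟩⟩
  have hf : Function.Bijective f := by
    refine ⟨fun v w hvw => Subtype.ext (g.injective (congrArg Subtype.val hvw)), ?_⟩
    rintro ⟨w, hw⟩
    obtain ⟨ρ, hρ, hρw⟩ := (h _).1 hw
    -- A simplex mapped injectively onto a singleton is itself a singleton, so vertices come from
    -- vertices.
    obtain ⟨v, rfl⟩ := Finset.card_eq_one.1 (by rw [← Finset.card_map g, hρw]; rfl)
    obtain rfl : g v = w := by simpa using hρw
    exact ⟨⟨v, hρ⟩, rfl⟩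
  let e := Equiv.ofBijective f hf
  have he (w : vertices K) : g (e.symm w) = w :=
    congrArg Subtype.val (Equiv.ofBijective_apply_symm_apply f hf w)
  refine ⟨e.symm, fun s => ?_⟩
  have hs : ((s.map e.symm.toEmbedding).map (Function.Embedding.subtype (· ∈ vertices L))).map g =
      s.map (Function.Embedding.subtype (· ∈ vertices K)) := by
    rw [Finset.map_map, Finset.map_map]
    congr 1
    ext w
    exact he w
  rw [h, ← hs]
  exact ⟨fun ⟨ρ, hρ, h⟩ => Finset.map_injective g h ▸ hρ, fun h => ⟨_, h, rfl⟩⟩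

theorem mem_cycle_six_iff {s : Finset (Fin 6)} :
    s ∈ (cycle 6).faces ↔ s.Nonempty ∧ ∃ i, s ⊆ {i, i + 1} := by
  have hadj (i j : Fin 6) : (SimpleGraph.cycleGraph 6).Adj i j ↔ j = i + 1 ∨ i = j + 1 := by
    rw [SimpleGraph.cycleGraph_adj]
    revert i j
    decide
  change (∃ v, s = {v}) ∨ s ∈ Sym2.toFinset '' (SimpleGraph.cycleGraph 6).edgeSet ↔ _
  constructor
  · rintro (⟨v, rfl⟩ | ⟨e, he, rfl⟩)
    · exact ⟨Finset.singleton_nonempty v, v, by simp⟩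
    · induction e with
      | _ i j =>
        rw [Sym2.toFinset_mk_eq]
        refine ⟨⟨i, by simp⟩, ?_⟩
        rcases (hadj i j).1 he with rfl | rfl
        · exact ⟨i, subset_rfl⟩
        · exact ⟨j, by rw [Finset.pair_comm]⟩
  · rintro ⟨hne, i, hi⟩
    have hs : s = ∅ ∨ s = {i} ∨ s = {i + 1} ∨ s = {i, i + 1} := by
      rw [← Finset.coe_subset, Finset.coe_pair, Set.subset_pair_iff_eq] at hi
      exact_mod_cast hi
    rcases hs with rfl | rfl | rfl | rfl
    · exact (Finset.not_nonempty_empty hne).elim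
    · exact Or.inl ⟨_, rfl⟩
    · exact Or.inl ⟨_, rfl⟩
    · exact Or.inr ⟨s(i, i + 1), (hadj _ _).2 (Or.inl rfl), Sym2.toFinset_mk_eq⟩

/-- The facets of the join of two hexagons. -/
def hexagonJoinFacets : Finset (Finset (Fin 6 ⊕ Fin 6)) :=
  (Finset.univ : Finset (Fin 6 × Fin 6)).image fun p =>
    {Sum.inl p.1, Sum.inl (p.1 + 1), Sum.inr p.2, Sum.inr (p.2 + 1)}

theorem join_cycle_six : join (cycle 6) (cycle 6) = ofFacets hexagonJoinFacets := by
  ext σ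
  have key (s : Finset (Fin 6)) : s = ∅ ∨ s ∈ (cycle 6).faces ↔ ∃ i, s ⊆ {i, i + 1} := by
    rw [mem_cycle_six_iff]
    rcases s.eq_empty_or_nonempty with rfl | hs
    · simp
    · simp [hs, hs.ne_empty]
  change (_ ∧ _ ∧ _) ↔ _
  rw [mem_ofFacets, key, key]
  refine and_congr_right fun _ => ?_
  simp only [hexagonJoinFacets, Finset.mem_image, Finset.mem_univ, true_and, Prod.exists]
  constructor
  · rintro ⟨⟨i, hi⟩, j, hj⟩
    refine ⟨_, ⟨i, j, rfl⟩, ?_⟩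
    rintro (k | k) hk
    · have := hi (Finset.mem_toLeft.2 hk)
      simpa using this
    · have := hj (Finset.mem_toRight.2 hk)
      simpa using this
  · rintro ⟨_, ⟨i, j, rfl⟩, h⟩
    refine ⟨⟨i, fun k hk => ?_⟩, j, fun k hk => ?_⟩
    · have := h (Finset.mem_toLeft.1 hk)
      simpa using this
    · have := h (Finset.mem_toRight.1 hk)
      simpa using this

/-- The vertices of the link of `(12)(34)`, arranged in two hexagons. -/
def hexagons : Fin 6 ⊕ Fin 6 ↪ Fin 15 where
  toFun := Sum.elim ![3, 7, 5, 6, 4, 8] ![9, 13, 11, 12, 10, 14]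
  inj' := by decide

/-- With letters and values counted from 0, (a, b) has number 3 + 3a + b. Around each hexagon of
`hexagons` the two paired letters alternate and adjacent values differ. -/
theorem linkFacets_zero :
    linkFacets 0 = hexagonJoinFacets.image fun f => f.map hexagons := by
  decide +kernel

theorem isomorphic_link_join :
    Isomorphic (link X {ν₁₂₃₄}) (join (cycle 6) (cycle 6)) := by
  have h0 : numbering ν₁₂₃₄ = 0 := numbering_inl 0
  refine isomorphic_of_map (hexagons.trans numbering.symm.toEmbedding) fun τ => ?_
  rw [mem_link_iff, h0, linkFacets_zero, join_cycle_six]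
  have hτ (ρ : Finset (Fin 6 ⊕ Fin 6)) :
      ρ.map (hexagons.trans numbering.symm.toEmbedding) = τ ↔
        ρ.map hexagons = τ.map numbering.toEmbedding := by
    rw [← (Finset.map_injective numbering.toEmbedding).eq_iff]
    simp [Finset.map_map, Function.Embedding.trans_assoc]
  simp only [hτ, mem_ofFacets, Finset.mem_image]
  constructor
  · rintro ⟨hne, _, ⟨f, hf, rfl⟩, h⟩
    obtain ⟨ρ, hρ, hρτ⟩ := Finset.subset_map_iff.1 h
    refine ⟨ρ, ⟨?_, f, hf, hρ⟩, hρτ.symm⟩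
    rwa [hρτ, Finset.map_nonempty] at hne
  · rintro ⟨ρ, ⟨hne, f, hf, hρ⟩, h⟩
    rw [← h]
    exact ⟨hne.map, _, ⟨f, hf, rfl⟩, Finset.map_subset_map.2 hρ⟩

end CombTop

theorem proposition1p3 :
    CombTop.IsCombinatorialManifold 4 CombTop.X ∧
      CombTop.Isomorphic (CombTop.link CombTop.X {CombTop.ν₁₂₃₄})
        (CombTop.join (CombTop.cycle 6) (CombTop.cycle 6)) :=
  ⟨CombTop.isCombinatorialManifold_X, CombTop.isomorphic_link_join⟩
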